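/- Let $\langle x\rangle=(1+|x|^2)^{1/2}$ and, for $s\in\mathbb{R}$, let $L^2_s(\mathbb{R}^3)$ be the weighted space of (a.e. classes of) measurable functions $f:\mathbb{R}^3\to\mathbb{C}$ with finite norm $\|f\|_{L^2_s}=\|\langle x\rangle^s f\|_{L^2(\mathbb{R}^3)}$. Let $D=|\nabla|=\sqrt{-\Delta}$ be the half-wave operator on $L^2(\mathbb{R}^3)$, i.e. the self-adjoint operator with domain $H^1(\mathbb{R}^3)$ that acts on the Fourier side as multiplication by $|\xi|$ (when the Fourier transform is normalised so that $\partial_j$ becomes multiplication by $i\xi_j$). **Lemma (Uniform limiting absorption principle for the half-wave operator).** Let $s>\tfrac12$ and $a_0>0$. Then there is a constant $C>0$, depending only on $s$ and $a_0$, such that for all $\lambda\ge a_0$, all $\varepsilon>0$ and both choices of the sign, the resolvent $(D-(\lambda\pm i\varepsilon))^{-1}$ exists as a bounded operator on $L^2(\mathbb{R}^3)$, maps $L^2_s(\mathbb{R}^3)\subset L^2(\mathbb{R}^3)$ into $L^2_{-s}(\mathbb{R}^3)$, and satisfies $$\big\|(D-(\lambda\pm i\varepsilon))^{-1}f\big\|_{L^2_{-s}(\mathbb{R}^3)}\le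 C\,\|f\|_{L^2_s(\mathbb{R}^3)}\qquad\text{for all } f\in L^2_s(\mathbb{R}^3).$$ Equivalently, $\sup_{\lambda\ge a_0,\ \varepsilon>0}\big\|(D-(\lambda\pm i\varepsilon))^{-1}\big\|_{L^2_s(\mathbb{R}^3)\to L^2_{-s}(\mathbb{R}^3)}<\infty$ for each sign. -/

import Mathlib

open MeasureTheory
open scoped FourierTransform ENNReal

noncomputable section

namespace HalfWave

/-- Three-dimensional Euclidean space. -/
abbrev R3 : Type := EuclideanSpace ℝ (Fin 3)

/-- The complex Hilbert space `L²(ℝ³)`. -/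
abbrev L2 : Type := Lp ℂ 2 (volume : Measure R3)

/-- The symbol of `|∇|`. Mathlib's Fourier transform has kernel `exp (-2πi x·ξ)`, for which
`∂ⱼ` becomes multiplication by `2πi ξⱼ`, so `-Δ` becomes `(2π|ξ|)²` and `|∇| = √(-Δ)` becomes
multiplication by `2π|ξ|`. -/
def absGradSymbol (ξ : R3) : ℂ := ((2 * Real.pi * ‖ξ‖ : ℝ) : ℂ)

/-- The function `ξ ↦ 2π|ξ| (𝓕 u)(ξ)`, where `𝓕` is the Fourier transform of `L²(ℝ³)`. -/
def absGradHat (u : L2) : R3 → ℂ := fun ξ => absGradSymbol ξ * (𝓕 u : L2) ξ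

theorem absGradHat_add (u v : L2) :
    absGradHat (u + v) =ᵐ[volume] absGradHat u + absGradHat v := by
  have h := Lp.coeFn_add (𝓕 u : L2) (𝓕 v : L2)
  rw [← FourierTransform.fourier_add] at h
  filter_upwards [h] with ξ hξ
  simp only [absGradHat, hξ, Pi.add_apply, mul_add]

theorem absGradHat_smul (c : ℂ) (u : L2) :
    absGradHat (c • u) =ᵐ[volume] c • absGradHat u := by
  have h := Lp.coeFn_smul c (𝓕 u : L2)
  rw [← FourierTransform.fourier_smul] at h
  filter_upwards [h] with ξ hξ
  simp only [absGradHat, hξ, Pi.smul_apply, smul_eq_mul]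
  ring

/-- The domain `{u ∈ L² : |ξ| 𝓕u ∈ L²}` of `|∇|`, that is, the Sobolev space `H¹(ℝ³)`. -/
def absGradDomain : Submodule ℂ L2 where
  carrier := {u | MemLp (absGradHat u) 2 volume}
  add_mem' {u v} hu hv := (memLp_congr_ae (absGradHat_add u v)).2 (hu.add hv)
  zero_mem' := by
    have h := absGradHat_smul 0 0
    rw [zero_smul, zero_smul] at h
    exact (memLp_congr_ae h).2 MemLp.zero
  smul_mem' c u hu := (memLp_congr_ae (absGradHat_smul c u)).2 (hu.const_smul c)

/-- The half-wave operator `|∇| = √(-Δ)` as an unbounded operator on `L²(ℝ³)`: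
`𝓕 (|∇| u) (ξ) = 2π|ξ| (𝓕 u)(ξ)` on the domain `H¹(ℝ³)`. -/
def absGrad : L2 →ₗ.[ℂ] L2 where
  domain := absGradDomain
  toFun :=
    { toFun := fun u => 𝓕⁻ (MemLp.toLp (absGradHat u) u.2)
      map_add' := fun u v => by
        rw [← FourierTransform.fourierInv_add]
        exact congrArg _ (((MemLp.toLp_eq_toLp_iff _ (u.2.add v.2)).2
          (absGradHat_add u v)).trans (MemLp.toLp_add u.2 v.2))
      map_smul' := fun c u => by
        rw [RingHom.id_apply, ← FourierTransform.fourierInv_smul]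
        exact congrArg _ (((MemLp.toLp_eq_toLp_iff _ (u.2.const_smul c)).2
          (absGradHat_smul c u)).trans (MemLp.toLp_const_smul c u.2)) }

/-- `R` is the resolvent `(A - z)⁻¹` of the unbounded operator `A` at `z`: a bounded operator on
the whole space that maps into the domain of `A` and is a two-sided inverse of `A - z`.
There is at most one such `R`. -/
def IsResolvent {H : Type*} [NormedAddCommGroup H] [NormedSpace ℂ H]
    (A : H →ₗ.[ℂ] H) (z : ℂ) (R : H →L[ℂ] H) : Prop :=
  (∀ f : H, ∃ h : R f ∈ A.domain, A ⟨R f, h⟩ - z • R f = f) ∧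
    ∀ u : A.domain, R (A u - z • (u : H)) = u

/-- The function `⟨x⟩ˢ f(x)`, where `⟨x⟩ = (1 + |x|²)^(1/2)`. -/
def weighted (s : ℝ) (f : R3 → ℂ) : R3 → ℂ :=
  fun x => (((Real.sqrt (1 + ‖x‖ ^ 2)) ^ s : ℝ) : ℂ) * f x

/-- `f` belongs to the weighted space `L²ₛ(ℝ³)`. -/
def MemL2Weighted (s : ℝ) (f : R3 → ℂ) : Prop := MemLp (weighted s f) 2 volume

/-- The norm `‖f‖_{L²ₛ} = ‖⟨x⟩ˢ f‖_{L²}`. -/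
def l2WeightedNorm (s : ℝ) (f : R3 → ℂ) : ℝ≥0∞ := eLpNorm (weighted s f) 2 volume

/-- For `s ≥ 0` the space `L²ₛ(ℝ³)` is contained in `L²(ℝ³)`. -/
theorem MemL2Weighted.memLp {s : ℝ} (hs : 0 ≤ s) {f : R3 → ℂ} (hf : MemL2Weighted s f) :
    MemLp f 2 volume := by
  have hpos : ∀ x : R3, 0 < Real.sqrt (1 + ‖x‖ ^ 2) := fun x => by positivity
  have hc : Continuous fun x : R3 => (((Real.sqrt (1 + ‖x‖ ^ 2)) ^ (-s) : ℝ) : ℂ) := by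
    refine Complex.continuous_ofReal.comp (Continuous.rpow_const (by fun_prop) fun x => ?_)
    exact Or.inl (hpos x).ne'
  have hfe : f = fun x => (((Real.sqrt (1 + ‖x‖ ^ 2)) ^ (-s) : ℝ) : ℂ) * weighted s f x := by
    funext x
    rw [weighted, ← mul_assoc, ← Complex.ofReal_mul, ← Real.rpow_add (hpos x)]
    simp
  have hmeas : AEStronglyMeasurable f volume := by
    rw [hfe]
    exact hc.aestronglyMeasurable.mul hf.aestronglyMeasurable
  refine hf.mono hmeas (Filter.Eventually.of_forall fun x => ?_)
  rw [weighted, norm_mul, Complex.norm_real, Real.norm_of_nonneg (Real.rpow_nonneg (hpos x).le s)]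
  refine le_mul_of_one_le_left (norm_nonneg _) (Real.one_le_rpow ?_ hs)
  rw [Real.one_le_sqrt]
  nlinarith [sq_nonneg ‖x‖]

end HalfWave

end

noncomputable section

namespace HalfWave

/-! ### Multiplication by bounded functions on `L²` -/

section BoundedMultiplication

variable {α : Type*} [MeasurableSpace α] {μ : Measure α}

/-! Write `r = 2π|ξ|`. The symbol of the resolvent satisfies `1/(r - z) = 1/(r + z) + 2z/(r² - z²)`,
and `2z/(r² - z²) = -2/z + (2/z) ∑ⱼ (2πξⱼ)²/(r² - z²)`. Since `Re z > 0`, the terms `1/(r + z)` and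
`2/z` are `O(1/|z|)`, which is harmless for `|z| ≥ a₀`.

For each `j` let `ρ = 2π|ξ'|`, with `ξ'` the remaining coordinates, and `σ² = ρ² - z²` with `Re σ >
0`. Then `(2πξⱼ)²/(r² - z²) = 1 - σ²/(σ² + (2πξⱼ)²)`, and `-(2/z) σ²/(σ² + (2πξⱼ)²)` is the Fourier
transform in `t` of `-(σ/z) exp(-σ|t|)`. The weight `ξⱼ²` has supplied the factor `σ` that cancels
the `1/σ` of the Helmholtz kernel, so for `ρ ≤ 2|z|` this kernel is bounded by 3, uniformly in `z`.
For `ρ > 2|z|` the term is nonsingular and stays `O(1/|z|)` (`norm_sub_singularSymbol_le`).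

A multiplier with kernel bounded in `t` should map `L¹` in `xⱼ` with values in `L²(ℝ²)` to the
corresponding `L^∞` space. The form used here is a uniform bound between unit slabs in `xⱼ`
(`norm_inner_multiplier_le_of_slab`). For `s > 1/2`, Cauchy–Schwarz makes the slab norms of an `L²ₛ`
function summable (`sum_norm_slabProj_le`), and duality concludes. -/

theorem memLp_mul_of_bound {q u : α → ℂ} {C : ℝ} (hq : Measurable q) (hC : ∀ x, ‖q x‖ ≤ C)
    (hu : MemLp u 2 μ) : MemLp (fun x => q x * u x) 2 μ :=
  hu.of_le_mul (c := C) (hq.aestronglyMeasurable.mul hu.aestronglyMeasurable)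
    (.of_forall fun x => by
      rw [norm_mul]; exact mul_le_mul_of_nonneg_right (hC x) (norm_nonneg _))

/-- The operator of multiplication by a bounded measurable function. -/
def bddMul (q : α → ℂ) (hq : Measurable q) (C : ℝ) (hC : ∀ x, ‖q x‖ ≤ C) :
    Lp ℂ 2 μ →L[ℂ] Lp ℂ 2 μ :=
  LinearMap.mkContinuous
    { toFun := fun u => (memLp_mul_of_bound hq hC (Lp.memLp u)).toLp _
      map_add' := fun u v => by
        rw [← MemLp.toLp_add, MemLp.toLp_eq_toLp_iff]
        filter_upwards [Lp.coeFn_add u v] with x hx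
        simp only [hx, Pi.add_apply, mul_add]
      map_smul' := fun c u => by
        rw [RingHom.id_apply, ← MemLp.toLp_const_smul, MemLp.toLp_eq_toLp_iff]
        filter_upwards [Lp.coeFn_smul c u] with x hx
        simp only [hx, Pi.smul_apply, smul_eq_mul]
        ring } C fun u => by
      refine Lp.norm_le_mul_norm_of_ae_le_mul ?_
      filter_upwards [(memLp_mul_of_bound hq hC (Lp.memLp u)).coeFn_toLp] with x hx
      simp only [LinearMap.coe_mk, AddHom.coe_mk]
      rw [hx, norm_mul]
      exact mul_le_mul_of_nonneg_right (hC x) (norm_nonneg _)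

variable {q : α → ℂ} {hq : Measurable q} {C : ℝ} {hC : ∀ x, ‖q x‖ ≤ C}

theorem coeFn_bddMul (u : Lp ℂ 2 μ) : bddMul q hq C hC u =ᵐ[μ] fun x => q x * u x :=
  (memLp_mul_of_bound hq hC (Lp.memLp u)).coeFn_toLp

theorem norm_bddMul_le (u : Lp ℂ 2 μ) : ‖bddMul q hq C hC u‖ ≤ C * ‖u‖ := by
  refine Lp.norm_le_mul_norm_of_ae_le_mul ?_
  filter_upwards [coeFn_bddMul (hq := hq) (hC := hC) u] with x hx
  rw [hx, norm_mul]
  exact mul_le_mul_of_nonneg_right (hC x) (norm_nonneg _)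

theorem inner_bddMul (u v : Lp ℂ 2 μ) :
    inner ℂ v (bddMul q hq C hC u) = ∫ x, q x * inner ℂ (v x) (u x) ∂μ := by
  rw [L2.inner_def]
  refine integral_congr_ae ?_
  filter_upwards [coeFn_bddMul (hq := hq) (hC := hC) u] with x hx
  rw [hx, ← smul_eq_mul, inner_smul_right]

end BoundedMultiplication

/-! ### Translations and the Fourier transform on `L²` -/

section Translation

variable {E : Type*} [NormedAddCommGroup E] [InnerProductSpace ℝ E]
  [MeasurableSpace E] [BorelSpace E]

theorem measurable_fourierChar_inner (a : E) :
    Measurable fun ξ : E => (Real.fourierChar (-inner ℝ ξ a) : ℂ) := by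
  have : Continuous fun ξ : E => (Real.fourierChar (-inner ℝ ξ a) : ℂ) := by fun_prop
  exact this.measurable

variable [FiniteDimensional ℝ E]

/-- Translation by `a` on `L²`. -/
def translateL2 (a : E) : Lp ℂ 2 (volume : Measure E) →ₗᵢ[ℂ] Lp ℂ 2 (volume : Measure E) :=
  Lp.compMeasurePreservingₗᵢ ℂ (fun x => x - a) (measurePreserving_sub_right volume a)

theorem coeFn_translateL2 (a : E) (u : Lp ℂ 2 (volume : Measure E)) :
    translateL2 a u =ᵐ[volume] fun x => u (x - a) :=
  Lp.coeFn_compMeasurePreserving u (measurePreserving_sub_right volume a)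

/-- Multiplication by the character `ξ ↦ exp (-2πi⟨ξ, a⟩)` on `L²`. -/
def modulateL2 (a : E) : Lp ℂ 2 (volume : Measure E) →L[ℂ] Lp ℂ 2 (volume : Measure E) :=
  bddMul (fun ξ => (Real.fourierChar (-inner ℝ ξ a) : ℂ)) (measurable_fourierChar_inner a) 1
    fun _ => (Circle.norm_coe _).le

/-- Both sides are continuous in `u`, so it suffices to compute on the dense subspace of Schwartz
functions. -/
theorem fourier_translateL2 (a : E) (u : Lp ℂ 2 (volume : Measure E)) :
    𝓕 (translateL2 a u) = modulateL2 a (𝓕 u) := by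
  refine DenseRange.induction_on (p := fun u => 𝓕 (translateL2 a u) = modulateL2 a (𝓕 u))
    (SchwartzMap.denseRange_toLpCLM (p := 2) ENNReal.ofNat_ne_top) u ?_ fun φ => ?_
  · exact isClosed_eq
      ((Lp.fourierTransformₗᵢ E ℂ).continuous.comp (translateL2 a).continuous)
      ((modulateL2 a).continuous.comp (Lp.fourierTransformₗᵢ E ℂ).continuous)
  · simp only [SchwartzMap.toLpCLM_apply]
    have h1 : translateL2 a (φ.toLp 2) = (SchwartzMap.compSubConstCLM ℂ a φ).toLp 2 := by
      refine Lp.ext ?_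
      have h := (measurePreserving_sub_right (volume : Measure E) a).quasiMeasurePreserving.ae_eq_comp
        (φ.coeFn_toLp 2 volume)
      filter_upwards [coeFn_translateL2 a (φ.toLp 2), h,
        (SchwartzMap.compSubConstCLM ℂ a φ).coeFn_toLp 2 volume] with x h1 h2 h3
      rw [h1, h3]
      exact h2
    rw [h1, SchwartzMap.toLp_fourier_eq, SchwartzMap.toLp_fourier_eq]
    refine Lp.ext ?_
    filter_upwards [(𝓕 φ).coeFn_toLp 2 volume, coeFn_bddMul (q := fun ξ => _)
      (hq := measurable_fourierChar_inner a) (hC := fun _ => (Circle.norm_coe _).le)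
      ((𝓕 φ).toLp 2 volume),
      (𝓕 (SchwartzMap.compSubConstCLM ℂ a φ)).coeFn_toLp 2 volume] with ξ h1 h2 h3
    rw [modulateL2, h2, h1, h3, SchwartzMap.fourier_coe, SchwartzMap.fourier_coe]
    have := congrFun (VectorFourier.fourierIntegral_comp_add_right Real.fourierChar volume
      (innerₗ E) φ (-a)) ξ
    simp only [innerₗ_apply_apply, inner_neg_left, Circle.smul_def, smul_eq_mul] at this
    rw [real_inner_comm]
    refine Eq.trans ?_ this
    rw [Real.fourier_eq]
    simp [VectorFourier.fourierIntegral, sub_eq_add_neg]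

/-- The Fourier transform of `ĝ̄ f̂` is the correlation of `f` and `g`. -/
theorem fourier_inner_fourier (f g : Lp ℂ 2 (volume : Measure E)) (a : E) :
    𝓕 (fun ξ => inner ℂ ((𝓕 g : Lp ℂ 2 (volume : Measure E)) ξ)
      ((𝓕 f : Lp ℂ 2 (volume : Measure E)) ξ)) a = inner ℂ g (translateL2 a f) := by
  rw [← Lp.inner_fourier_eq, fourier_translateL2, modulateL2, inner_bddMul, Real.fourier_eq]
  rfl

/-- A test function `g` is the Fourier transform of a Schwartz function; moving the transform across
the pairing turns `∫ g f` into an integral against `𝓕 f = 0`. -/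
theorem ae_eq_zero_of_fourier_eq_zero {f : E → ℂ} (hf : Integrable f) (h : ∀ x, 𝓕 f x = 0) :
    f =ᵐ[volume] 0 := by
  refine ae_eq_zero_of_integral_contDiff_smul_eq_zero hf.locallyIntegrable fun g hg hgc => ?_
  have hc : HasCompactSupport (Complex.ofRealCLM ∘ g) := hgc.comp_left rfl
  have hs : ContDiff ℝ ((⊤ : ℕ∞) : WithTop ℕ∞) (Complex.ofRealCLM ∘ g) := by fun_prop
  set ψ : SchwartzMap E ℂ := hc.toSchwartzMap hs
  have hψ : ∀ x, (𝓕 (𝓕⁻ ψ : SchwartzMap E ℂ)) x = (g x : ℂ) := fun x => by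
    rw [FourierTransform.fourier_fourierInv_eq]; rfl
  have key := VectorFourier.integral_fourierIntegral_smul_eq_flip (L := innerₗ E)
    (μ := volume) (ν := volume) Real.continuous_fourierChar (by exact continuous_inner) hf
    (𝓕⁻ ψ : SchwartzMap E ℂ).integrable
  have h0 : ∀ x, VectorFourier.fourierIntegral Real.fourierChar volume (innerₗ E) f x = 0 := h
  simp only [h0, zero_smul, integral_zero, flip_innerₗ] at key
  rw [key]
  refine integral_congr_ae (.of_forall fun x => ?_)
  have := hψ x
  rw [SchwartzMap.fourier_coe] at this
  simp only [smul_eq_mul, Complex.real_smul]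
  rw [← this, mul_comm]
  rfl

end Translation

/-! ### Splitting off one coordinate of `ℝ³` -/

/-- The Euclidean plane. -/
abbrev R2 : Type := EuclideanSpace ℝ (Fin 2)

/-- The splitting `ℝ³ ≃ ℝ × ℝ²` that singles out the coordinate `j`. -/
def splitEquiv (j : Fin 3) : R3 ≃ᵐ ℝ × R2 :=
  ((MeasurableEquiv.toLp 2 (Fin 3 → ℝ)).symm.trans
    (MeasurableEquiv.piFinSuccAbove (fun _ => ℝ) j)).trans
    ((MeasurableEquiv.refl ℝ).prodCongr (MeasurableEquiv.toLp 2 (Fin 2 → ℝ)))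

theorem measurePreserving_splitEquiv (j : Fin 3) :
    MeasurePreserving (splitEquiv j) volume (volume.prod volume) :=
  ((PiLp.volume_preserving_ofLp (Fin 3)).trans
    (volume_preserving_piFinSuccAbove (fun _ : Fin 3 => ℝ) j)).trans
    ((MeasurePreserving.id volume).prod (PiLp.volume_preserving_toLp (Fin 2)))

/-- The coordinates of `ξ` other than the `j`-th. -/
def dropCoord (j : Fin 3) (ξ : R3) : R2 := (splitEquiv j ξ).2

theorem measurable_dropCoord (j : Fin 3) : Measurable (dropCoord j) :=
  measurable_snd.comp (splitEquiv j).measurable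

theorem splitEquiv_fst (j : Fin 3) (ξ : R3) : (splitEquiv j ξ).1 = ξ j := rfl

theorem inner_eq_split (j : Fin 3) (ξ x : R3) :
    inner ℝ ξ x = ξ j * x j + inner ℝ (dropCoord j ξ) (dropCoord j x) := by
  rw [PiLp.inner_apply, PiLp.inner_apply, Fin.sum_univ_succAbove _ j]
  simp only [RCLike.inner_apply, conj_trivial]
  rw [mul_comm]
  rfl

theorem norm_sq_eq_split (j : Fin 3) (ξ : R3) : ‖ξ‖ ^ 2 = ξ j ^ 2 + ‖dropCoord j ξ‖ ^ 2 := by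
  rw [← real_inner_self_eq_norm_sq, ← real_inner_self_eq_norm_sq, inner_eq_split j, sq]

theorem splitEquiv_symm_apply (j : Fin 3) (t : ℝ) (y : R2) :
    (splitEquiv j).symm (t, y) j = t := by
  rw [← splitEquiv_fst, MeasurableEquiv.apply_symm_apply]

theorem dropCoord_splitEquiv_symm (j : Fin 3) (t : ℝ) (y : R2) :
    dropCoord j ((splitEquiv j).symm (t, y)) = y := by
  rw [dropCoord, MeasurableEquiv.apply_symm_apply]

theorem integral_eq_integral_split (j : Fin 3) {F : R3 → ℂ} (hF : Integrable F) :
    ∫ ξ, F ξ = ∫ y : R2, ∫ τ : ℝ, F ((splitEquiv j).symm (τ, y)) := by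
  have h := (measurePreserving_splitEquiv j).symm
  rw [← h.integral_comp (splitEquiv j).symm.measurableEmbedding, integral_prod_symm]
  exact (h.integrable_comp_emb (splitEquiv j).symm.measurableEmbedding).2 hF

/-- If the Fourier transform of `P ∈ L¹(ℝ³)` vanishes on the plane `x_j = t`, then so does that of
the product of `P` with any bounded function that does not depend on `ξ_j`. -/
theorem integral_mul_eq_zero_of_fourier_eq_zero (j : Fin 3) {P : R3 → ℂ} (hP : Integrable P)
    {t : ℝ} (h : ∀ x : R3, x j = t → 𝓕 P x = 0) {k : R2 → ℂ} (hk : Measurable k) {A : ℝ}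
    (hA : ∀ y, ‖k y‖ ≤ A) :
    ∫ ξ, k (dropCoord j ξ) * ((Real.fourierChar (-(t * ξ j)) : ℂ) * P ξ) = 0 := by
  have hchar : ∀ a : R3, Measurable fun ξ : R3 => (Real.fourierChar (-inner ℝ ξ a) : ℂ) :=
    measurable_fourierChar_inner
  have hmeas : Measurable fun ξ : R3 => (Real.fourierChar (-(t * ξ j)) : ℂ) := by
    have : Continuous fun ξ : R3 => (Real.fourierChar (-(t * ξ j)) : ℂ) := by fun_prop
    exact this.measurable
  have hint : Integrable fun ξ : R3 => (Real.fourierChar (-(t * ξ j)) : ℂ) * P ξ :=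
    hP.bdd_mul hmeas.aestronglyMeasurable (.of_forall fun _ => (Circle.norm_coe _).le)
  set Q : R2 → ℂ := fun y => ∫ τ : ℝ, (Real.fourierChar (-(t * τ)) : ℂ) *
    P ((splitEquiv j).symm (τ, y)) with hQdef
  have hs := (measurePreserving_splitEquiv j).symm
  have hQ : Integrable Q := by
    have h1 := (hs.integrable_comp_emb (splitEquiv j).symm.measurableEmbedding).2 hint
    have h2 := h1.integral_prod_right
    simpa only [Function.comp_def, splitEquiv_symm_apply] using h2
  -- By Fubini, the Fourier transform of `Q` at `x` is that of `P` at the point of the plane `xⱼ =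
  -- t` with other coordinates `x`.
  have hQ0 : Q =ᵐ[volume] 0 := by
    refine ae_eq_zero_of_fourier_eq_zero hQ fun x => ?_
    have h0 := h ((splitEquiv j).symm (t, x)) (splitEquiv_symm_apply j t x)
    rw [Real.fourier_eq, integral_eq_integral_split j] at h0
    · rw [Real.fourier_eq, ← h0]
      refine integral_congr_ae (.of_forall fun y => ?_)
      simp only [hQdef, Circle.smul_def, smul_eq_mul]
      rw [← integral_const_mul]
      refine integral_congr_ae (.of_forall fun τ => ?_)
      simp only [inner_eq_split j, splitEquiv_symm_apply, dropCoord_splitEquiv_symm]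
      rw [← mul_assoc, ← Circle.coe_mul, ← AddChar.map_add_eq_mul]
      congr 4
      ring
    · simp only [Circle.smul_def, smul_eq_mul]
      exact hP.bdd_mul (hchar _).aestronglyMeasurable
        (.of_forall fun _ => (Circle.norm_coe _).le)
  have hkint : Integrable fun ξ : R3 =>
      k (dropCoord j ξ) * ((Real.fourierChar (-(t * ξ j)) : ℂ) * P ξ) :=
    hint.bdd_mul (hk.comp (measurable_dropCoord j)).aestronglyMeasurable
      (.of_forall fun _ => hA _)
  rw [integral_eq_integral_split j hkint]
  refine integral_eq_zero_of_ae ?_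
  filter_upwards [hQ0] with y hy
  simp only [splitEquiv_symm_apply, dropCoord_splitEquiv_symm, integral_const_mul]
  change k y * Q y = 0
  rw [hy, Pi.zero_apply, mul_zero]

/-! ### Multipliers on slabs -/

/-- `f` vanishes outside of the slab `n ≤ x_j < n + 1`. -/
def SupportedInSlab (j : Fin 3) (n : ℤ) (f : L2) : Prop :=
  ∀ᵐ x : R3, ¬ ((n : ℝ) ≤ x j ∧ x j < n + 1) → f x = 0

/-- Points of slabs `m` and `n` have `j`-th coordinates that differ from each other by `m - n` up to
an error below 1, so the translate of `f` is disjoint from `g`. -/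
theorem inner_translateL2_eq_zero {j : Fin 3} {n m : ℤ} {f g : L2} (hf : SupportedInSlab j n f)
    (hg : SupportedInSlab j m g) {a : R3} (ha : 1 ≤ |a j - (m - n)|) :
    inner ℂ g (translateL2 a f) = 0 := by
  rw [L2.inner_def]
  refine integral_eq_zero_of_ae ?_
  have hf' := (measurePreserving_sub_right (volume : Measure R3) a).quasiMeasurePreserving.ae hf
  filter_upwards [coeFn_translateL2 a f, hf', hg] with x h1 h2 h3
  rw [h1, Pi.zero_apply]
  by_cases hx : (m : ℝ) ≤ x j ∧ x j < m + 1
  · rw [h2, inner_zero_right]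
    rintro ⟨h4, h5⟩
    rw [PiLp.sub_apply] at h4 h5
    have : |a j - (m - n)| < 1 := by rw [abs_lt]; constructor <;> linarith [hx.1, hx.2]
    linarith
  · rw [h3 hx, inner_zero_left]

/-- A multiplier `∫ K(t, ξ') exp (-2πi t ξ_j) dt`, where `ξ'` are the coordinates other than `ξ_j`
and `K` is bounded, is bounded between slabs, uniformly in the slabs. -/
theorem norm_inner_multiplier_le_of_slab {j : Fin 3} {n m : ℤ} {f g : L2}
    (hf : SupportedInSlab j n f) (hg : SupportedInSlab j m g) {K : ℝ → R2 → ℂ}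
    (hK : Measurable (Function.uncurry K)) {A : ℝ} (hA : ∀ t y, ‖K t y‖ ≤ A) {B : ℝ → ℝ}
    (hB : Integrable B) (hKB : ∀ t y, ‖K t y‖ ≤ B t) :
    ‖∫ ξ : R3, (∫ t : ℝ, K t (dropCoord j ξ) * (Real.fourierChar (-(t * ξ j)) : ℂ)) *
      inner ℂ ((𝓕 g : L2) ξ) ((𝓕 f : L2) ξ)‖ ≤ 2 * A * ‖f‖ * ‖g‖ := by
  set P : R3 → ℂ := fun ξ => inner ℂ ((𝓕 g : L2) ξ) ((𝓕 f : L2) ξ) with hPdef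
  have hP : Integrable P := L2.integrable_inner _ _
  have hcm : Measurable fun p : ℝ × R3 => (Real.fourierChar (-(p.1 * p.2 j)) : ℂ) := by
    have : Continuous fun p : ℝ × R3 => (Real.fourierChar (-(p.1 * p.2 j)) : ℂ) := by fun_prop
    exact this.measurable
  have hKm : Measurable fun p : ℝ × R3 => K p.1 (dropCoord j p.2) :=
    hK.comp (measurable_fst.prodMk ((measurable_dropCoord j).comp measurable_snd))
  have hint : Integrable (Function.uncurry fun (t : ℝ) (ξ : R3) =>
      K t (dropCoord j ξ) * ((Real.fourierChar (-(t * ξ j)) : ℂ) * P ξ))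
      -- The majorant `B` only justifies Fubini; it does not enter the final bound.
      (volume.prod volume) := by
    refine (hB.mul_prod hP.norm).mono' (hKm.aestronglyMeasurable.mul
      (hcm.aestronglyMeasurable.mul hP.1.comp_snd)) (.of_forall fun p => ?_)
    simp only [Function.uncurry, norm_mul, Circle.norm_coe, one_mul]
    exact mul_le_mul_of_nonneg_right (hKB _ _) (norm_nonneg _)
  have hswap : ∫ ξ : R3, (∫ t : ℝ, K t (dropCoord j ξ) *
      (Real.fourierChar (-(t * ξ j)) : ℂ)) * P ξ =
      ∫ t : ℝ, ∫ ξ : R3, K t (dropCoord j ξ) *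
        ((Real.fourierChar (-(t * ξ j)) : ℂ) * P ξ) := by
    rw [integral_integral_swap hint]
    refine integral_congr_ae (.of_forall fun ξ => ?_)
    simp only [← integral_mul_const, mul_assoc]
  -- The transform of `P` is the correlation of `f` and `g`, which vanishes on the whole plane `xⱼ =
  -- t` unless `t` is within 1 of `m - n`.
  have hzero : ∀ t : ℝ, t ∉ Set.Icc ((m - n : ℝ) - 1) (m - n + 1) → ∫ ξ : R3,
      K t (dropCoord j ξ) * ((Real.fourierChar (-(t * ξ j)) : ℂ) * P ξ) = 0 := fun t ht => by
    refine integral_mul_eq_zero_of_fourier_eq_zero j hP (fun x hx => ?_)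
      (hK.comp measurable_prodMk_left) (hA t)
    rw [hPdef, fourier_inner_fourier, inner_translateL2_eq_zero hf hg]
    rw [hx]
    by_contra hlt
    rw [not_le, abs_lt] at hlt
    exact ht ⟨by linarith [hlt.1], by linarith [hlt.2]⟩
  rw [hswap, ← setIntegral_eq_integral_of_forall_compl_eq_zero hzero]
  have hb : ∀ t ∈ Set.Icc ((m - n : ℝ) - 1) (m - n + 1), ‖∫ ξ : R3,
      K t (dropCoord j ξ) * ((Real.fourierChar (-(t * ξ j)) : ℂ) * P ξ)‖ ≤
      A * (‖f‖ * ‖g‖) := fun t _ => by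
    have hq : Measurable fun ξ : R3 =>
        K t (dropCoord j ξ) * (Real.fourierChar (-(t * ξ j)) : ℂ) :=
      (hKm.comp measurable_prodMk_left).mul (hcm.comp measurable_prodMk_left)
    have hqA : ∀ ξ : R3, ‖K t (dropCoord j ξ) * (Real.fourierChar (-(t * ξ j)) : ℂ)‖ ≤ A :=
      fun ξ => by rw [norm_mul, Circle.norm_coe, mul_one]; exact hA _ _
    have h := inner_bddMul (hq := hq) (hC := hqA) (𝓕 f : L2) (𝓕 g : L2)
    simp only [mul_assoc] at h
    rw [← h]
    refine (norm_inner_le_norm _ _).trans ?_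
    rw [Lp.norm_fourier_eq]
    have h2 := norm_bddMul_le (hq := hq) (hC := hqA) (𝓕 f : L2)
    rw [Lp.norm_fourier_eq] at h2
    nlinarith [mul_le_mul_of_nonneg_left h2 (norm_nonneg g)]
  refine (norm_setIntegral_le_of_norm_le_const measure_Icc_lt_top hb).trans (le_of_eq ?_)
  -- The surviving interval of `t` has length 2, whence the factor 2.
  rw [Measure.real, Real.volume_Icc, ENNReal.toReal_ofReal (by linarith)]
  ring

/-! ### Decomposition of weighted functions into slabs -/

/-- The set of points whose `j`-th coordinate has integer part in `S`. -/
def slabs (j : Fin 3) (S : Set ℤ) : Set R3 := {x | ⌊x j⌋ ∈ S}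

theorem measurableSet_slabs (j : Fin 3) (S : Set ℤ) : MeasurableSet (slabs j S) := by
  have h : Measurable fun x : R3 => ⌊x j⌋ := Int.measurable_floor.comp (by fun_prop)
  exact h (MeasurableSet.of_discrete (s := S))

theorem norm_indicator_one_le {α : Type*} (S : Set α) (x : α) :
    ‖S.indicator (fun _ => (1 : ℂ)) x‖ ≤ 1 := by
  by_cases h : x ∈ S <;> simp [h]

/-- The restriction of `f ∈ L²(ℝ³)` to `slabs j S`. -/
def slabProj (j : Fin 3) (S : Set ℤ) : L2 →L[ℂ] L2 :=
  bddMul ((slabs j S).indicator fun _ => 1)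
    (measurable_const.indicator (measurableSet_slabs j S)) 1 (norm_indicator_one_le _)

theorem coeFn_slabProj (j : Fin 3) (S : Set ℤ) (f : L2) :
    slabProj j S f =ᵐ[volume] fun x => (slabs j S).indicator (fun _ => 1) x * f x :=
  coeFn_bddMul f

theorem norm_slabProj_le (j : Fin 3) (S : Set ℤ) (f : L2) : ‖slabProj j S f‖ ≤ ‖f‖ :=
  (norm_bddMul_le f).trans_eq (one_mul _)

theorem supportedInSlab_slabProj (j : Fin 3) (n : ℤ) (f : L2) :
    SupportedInSlab j n (slabProj j {n} f) := by
  filter_upwards [coeFn_slabProj j {n} f] with x hx hn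
  rw [hx, Set.indicator_of_notMem, zero_mul]
  simpa only [slabs, Set.mem_ofPred_eq, Set.mem_singleton_iff, Int.floor_eq_iff] using hn

theorem sum_slabProj (j : Fin 3) (F : Finset ℤ) (f : L2) :
    ∑ n ∈ F, slabProj j {n} f = slabProj j F f := by
  induction F using Finset.induction_on with
  | empty =>
    rw [Finset.sum_empty]
    refine Lp.ext ?_
    filter_upwards [coeFn_slabProj j (∅ : Finset ℤ) f, Lp.coeFn_zero ℂ 2 (volume : Measure R3)]
      with x h1 h2
    rw [h1, h2]
    simp [slabs]
  | insert a F ha ih =>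
    rw [Finset.sum_insert ha, ih]
    refine Lp.ext ?_
    filter_upwards [coeFn_slabProj j (insert a F : Finset ℤ) f, coeFn_slabProj j F f,
      coeFn_slabProj j {a} f, Lp.coeFn_add (slabProj j {a} f) (slabProj j F f)] with x h1 h2 h3 h4
    rw [h1, h4, Pi.add_apply, h2, h3, ← add_mul]
    congr 1
    by_cases h5 : ⌊x j⌋ = a
    · have : a ∉ F := ha
      simp [slabs, h5, this]
    · by_cases h6 : ⌊x j⌋ ∈ F <;> simp [slabs, h5, h6]

theorem norm_sq_slabProj (j : Fin 3) (S : Set ℤ) (f : L2) :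
    inner ℂ f (slabProj j S f) = (‖slabProj j S f‖ ^ 2 : ℝ) := by
  have h : inner ℂ (slabProj j S f) (slabProj j S f) = ((‖slabProj j S f‖ ^ 2 : ℝ) : ℂ) := by
    rw [inner_self_eq_norm_sq_to_K]
    push_cast
    rfl
  rw [← h, L2.inner_def, L2.inner_def]
  refine integral_congr_ae ?_
  filter_upwards [coeFn_slabProj j S f] with x hx
  rw [hx]
  by_cases h : x ∈ slabs j S <;> simp [h]

/-- The quadratic form `⟨f, P_S f⟩ = ‖P_S f‖²` is additive over disjoint slabs, which gives
Pythagoras. -/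
theorem sum_norm_sq_slabProj_le (j : Fin 3) (F : Finset ℤ) (f : L2) :
    ∑ n ∈ F, ‖slabProj j {n} f‖ ^ 2 ≤ ‖f‖ ^ 2 := by
  have h : ((∑ n ∈ F, ‖slabProj j {n} f‖ ^ 2 : ℝ) : ℂ) = (‖slabProj j F f‖ ^ 2 : ℝ) := by
    rw [← norm_sq_slabProj, ← sum_slabProj, inner_sum, Complex.ofReal_sum]
    simp only [norm_sq_slabProj]
  rw [Complex.ofReal_inj.1 h]
  exact pow_le_pow_left₀ (norm_nonneg _) (norm_slabProj_le j F f) 2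

theorem one_add_abs_floor_le (j : Fin 3) (x : R3) :
    1 + |(⌊x j⌋ : ℝ)| ≤ 3 * Real.sqrt (1 + ‖x‖ ^ 2) := by
  have h1 : 1 ≤ Real.sqrt (1 + ‖x‖ ^ 2) := by
    rw [Real.one_le_sqrt]; nlinarith [sq_nonneg ‖x‖]
  have h2 : ‖x‖ ≤ Real.sqrt (1 + ‖x‖ ^ 2) := Real.le_sqrt_of_sq_le (by linarith)
  have h3 : |x j| ≤ ‖x‖ := PiLp.norm_apply_le x j
  have h4 : |(⌊x j⌋ : ℝ)| ≤ |x j| + 1 := by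
    have := Int.floor_le (x j)
    have := Int.lt_floor_add_one (x j)
    rw [abs_le]
    constructor <;> cases abs_cases (x j) <;> linarith
  linarith

theorem norm_le_weighted {s : ℝ} (hs : 0 ≤ s) (j : Fin 3) (f : R3 → ℂ) (x : R3) {r : ℝ}
    (hr : 0 < r) (hx : r ≤ 1 + |(⌊x j⌋ : ℝ)|) :
    ‖f x‖ ≤ (3 ^ s * r ^ (-s)) * ‖weighted s f x‖ := by
  have hpos : 0 < Real.sqrt (1 + ‖x‖ ^ 2) := by positivity
  rw [weighted, norm_mul, Complex.norm_real, Real.norm_of_nonneg (by positivity), ← mul_assoc]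
  refine le_mul_of_one_le_left (norm_nonneg _) ?_
  have h1 := Real.rpow_le_rpow hr.le (hx.trans (one_add_abs_floor_le j x)) hs
  rw [Real.mul_rpow (by norm_num) hpos.le] at h1
  have h2 : r ^ s * r ^ (-s) = 1 := by rw [← Real.rpow_add hr, add_neg_cancel, Real.rpow_zero]
  have h3 : 0 < r ^ (-s) := by positivity
  nlinarith [mul_le_mul_of_nonneg_right h1 h3.le]

/-- On slab `n` the weight `⟨x⟩ˢ` is at least `3⁻ˢ (1 + |n|)ˢ`. It serves both the single slabs and
the tail of the decomposition. -/
theorem norm_slabProj_le_weighted {s : ℝ} (hs : 0 ≤ s) (j : Fin 3) {f u : L2}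
    (hu : u =ᵐ[volume] weighted s f) (S : Set ℤ) {r : ℝ} (hr : 0 < r)
    (hS : ∀ n ∈ S, r ≤ 1 + |(n : ℝ)|) :
    ‖slabProj j S f‖ ≤ (3 ^ s * r ^ (-s)) * ‖slabProj j S u‖ := by
  refine Lp.norm_le_mul_norm_of_ae_le_mul ?_
  filter_upwards [coeFn_slabProj j S f, coeFn_slabProj j S u, hu] with x h1 h2 h3
  rw [h1, h2, h3]
  by_cases h : x ∈ slabs j S
  · simpa [h] using norm_le_weighted hs j f x hr (hS _ h)
  · simp [h]

theorem summable_one_add_abs_int_rpow {b : ℝ} (hb : 1 < b) :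
    Summable fun n : ℤ => (1 + |(n : ℝ)|) ^ (-b) := by
  refine Summable.of_norm_bounded_eventually (Real.summable_abs_int_rpow hb) ?_
  filter_upwards [(Set.finite_singleton (0 : ℤ)).compl_mem_cofinite] with n hn
  have hn' : 0 < |(n : ℝ)| := by simpa using hn
  rw [Real.norm_of_nonneg (by positivity)]
  exact Real.rpow_le_rpow_of_nonpos hn' (by linarith) (by linarith)

/-- The constant of the embedding of `L²ₛ` into the functions with `ℓ¹`-summable slab norms. -/
def slabConst (s : ℝ) : ℝ := 3 ^ s * Real.sqrt (∑' n : ℤ, (1 + |(n : ℝ)|) ^ (-(2 * s)))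

theorem slabConst_nonneg (s : ℝ) : 0 ≤ slabConst s := by unfold slabConst; positivity

theorem sum_norm_slabProj_le {s : ℝ} (hs : 1 / 2 < s) (j : Fin 3) {f u : L2}
    (hu : u =ᵐ[volume] weighted s f) (F : Finset ℤ) :
    ∑ n ∈ F, ‖slabProj j {n} f‖ ≤ slabConst s * ‖u‖ := by
  have hs0 : 0 ≤ s := by linarith
  have h1 : ∑ n ∈ F, ‖slabProj j {n} f‖ ≤
      3 ^ s * ∑ n ∈ F, (1 + |(n : ℝ)|) ^ (-s) * ‖slabProj j {n} u‖ := by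
    rw [Finset.mul_sum]
    refine Finset.sum_le_sum fun n _ => ?_
    rw [← mul_assoc]
    exact norm_slabProj_le_weighted hs0 j hu {n} (by positivity) (by simp)
  have h2 := Real.sum_mul_le_sqrt_mul_sqrt F (fun n : ℤ => (1 + |(n : ℝ)|) ^ (-s))
    fun n => ‖slabProj j {n} u‖
  have h3 : Real.sqrt (∑ n ∈ F, ((1 + |(n : ℝ)|) ^ (-s)) ^ 2) ≤
      Real.sqrt (∑' n : ℤ, (1 + |(n : ℝ)|) ^ (-(2 * s))) := by
    refine Real.sqrt_le_sqrt ?_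
    have h4 : ∀ n : ℤ, ((1 + |(n : ℝ)|) ^ (-s)) ^ 2 = (1 + |(n : ℝ)|) ^ (-(2 * s)) := fun n => by
      rw [← Real.rpow_natCast, ← Real.rpow_mul (by positivity)]
      congr 1
      push_cast
      ring
    simp only [h4]
    -- The exponent `2s` exceeds 1: this is where `s > 1/2` is indispensable.
    exact (summable_one_add_abs_int_rpow (by linarith)).sum_le_tsum F fun _ _ => by positivity
  have h5 : Real.sqrt (∑ n ∈ F, ‖slabProj j {n} u‖ ^ 2) ≤ ‖u‖ :=
    Real.sqrt_le_iff.2 ⟨norm_nonneg _, sum_norm_sq_slabProj_le j F u⟩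
  refine h1.trans ?_
  rw [slabConst, mul_assoc]
  refine mul_le_mul_of_nonneg_left (h2.trans ?_) (by positivity)
  exact mul_le_mul h3 h5 (Real.sqrt_nonneg _) (Real.sqrt_nonneg _)

theorem tendsto_slabProj {s : ℝ} (hs : 0 < s) (j : Fin 3) {f u : L2}
    (hu : u =ᵐ[volume] weighted s f) :
    Filter.Tendsto (fun N : ℕ => slabProj j (Finset.Icc (-(N : ℤ)) N : Finset ℤ) f)
      Filter.atTop (nhds f) := by
  have hlim : Filter.Tendsto (fun N : ℕ => 3 ^ s * (1 + N : ℝ) ^ (-s) * ‖u‖)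
      Filter.atTop (nhds 0) := by
    have h := (tendsto_rpow_neg_atTop hs).comp
      (Filter.tendsto_atTop_add_const_left _ (1 : ℝ) tendsto_natCast_atTop_atTop)
    simpa using (h.const_mul (3 ^ s)).mul_const ‖u‖
  rw [tendsto_iff_norm_sub_tendsto_zero]
  refine squeeze_zero (fun _ => norm_nonneg _) (fun N => ?_) hlim
  set F : Finset ℤ := Finset.Icc (-(N : ℤ)) N
  have hcompl : slabProj j F f - f = -slabProj j (F : Set ℤ)ᶜ f := by
    rw [sub_eq_iff_eq_add, ← sub_eq_neg_add, eq_sub_iff_add_eq]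
    refine Lp.ext ?_
    filter_upwards [coeFn_slabProj j F f, coeFn_slabProj j (F : Set ℤ)ᶜ f,
      Lp.coeFn_add (slabProj j F f) (slabProj j (F : Set ℤ)ᶜ f)] with x h1 h2 h3
    rw [h3, Pi.add_apply, h1, h2]
    by_cases h : ⌊x j⌋ ∈ F <;> simp [slabs, h]
  rw [hcompl, norm_neg]
  refine (norm_slabProj_le_weighted hs.le j hu (F : Set ℤ)ᶜ (r := 1 + N) (by positivity)
    fun n hn => ?_).trans (mul_le_mul_of_nonneg_left (norm_slabProj_le _ _ _) (by positivity))
  have h : (N : ℤ) ≤ |n| := by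
    by_contra hlt
    rw [not_le, abs_lt] at hlt
    exact hn (Finset.coe_Icc (-(N : ℤ)) N ▸ ⟨hlt.1.le, hlt.2.le⟩)
  have h' : (N : ℝ) ≤ |(n : ℝ)| := by exact_mod_cast h
  linarith

/-- An operator which is bounded between slabs, uniformly in the slabs, is bounded from `L²ₛ` to
`L²₋ₛ` for `s > 1/2`. -/
theorem norm_inner_le_of_slab_bound {s : ℝ} (hs : 1 / 2 < s) (j : Fin 3) (T : L2 →L[ℂ] L2)
    {D : ℝ} (hD : 0 ≤ D)
    (hT : ∀ (n m : ℤ) (f g : L2), SupportedInSlab j n f → SupportedInSlab j m g →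
      ‖inner ℂ g (T f)‖ ≤ D * ‖f‖ * ‖g‖)
    {f g u v : L2} (hu : u =ᵐ[volume] weighted s f) (hv : v =ᵐ[volume] weighted s g) :
    ‖inner ℂ g (T f)‖ ≤ D * slabConst s ^ 2 * ‖u‖ * ‖v‖ := by
  have hs0 : 0 < s := by linarith
  have hlim := ((tendsto_slabProj hs0 j hv).inner
    ((T.continuous.tendsto f).comp (tendsto_slabProj hs0 j hu)) (𝕜 := ℂ)).norm
  -- The boundedness of `T` is used only to pass to the limit; the estimate of the truncations
  -- involves `D` alone.
  refine le_of_tendsto hlim (.of_forall fun N => ?_)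
  set F : Finset ℤ := Finset.Icc (-(N : ℤ)) N
  simp only [Function.comp_apply]
  rw [← sum_slabProj, ← sum_slabProj, map_sum, sum_inner]
  simp only [inner_sum]
  calc ‖∑ m ∈ F, ∑ n ∈ F, inner ℂ (slabProj j {m} g) (T (slabProj j {n} f))‖
      ≤ ∑ m ∈ F, ∑ n ∈ F, D * ‖slabProj j {n} f‖ * ‖slabProj j {m} g‖ := by
        refine (norm_sum_le _ _).trans (Finset.sum_le_sum fun m _ => ?_)
        refine (norm_sum_le _ _).trans (Finset.sum_le_sum fun n _ => ?_)
        exact hT n m _ _ (supportedInSlab_slabProj _ _ _) (supportedInSlab_slabProj _ _ _)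
    _ = D * (∑ n ∈ F, ‖slabProj j {n} f‖) * ∑ m ∈ F, ‖slabProj j {m} g‖ := by
        rw [Finset.mul_sum, Finset.mul_sum]
        exact Finset.sum_congr rfl fun m _ => (Finset.sum_mul _ _ _).symm
    _ ≤ D * (slabConst s * ‖u‖) * (slabConst s * ‖v‖) := by
        have h1 := sum_norm_slabProj_le hs j hu F
        have h2 := sum_norm_slabProj_le hs j hv F
        have := slabConst_nonneg s
        gcongr
    _ = D * slabConst s ^ 2 * ‖u‖ * ‖v‖ := by ring

/-! ### Fourier multipliers -/

/-- The Fourier multiplier with a bounded measurable symbol. -/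
def fourierMul (q : R3 → ℂ) (hq : Measurable q) (C : ℝ) (hC : ∀ ξ, ‖q ξ‖ ≤ C) : L2 →L[ℂ] L2 :=
  ((Lp.fourierTransformₗᵢ R3 ℂ).symm : L2 →L[ℂ] L2) ∘L bddMul q hq C hC ∘L
    (Lp.fourierTransformₗᵢ R3 ℂ : L2 →L[ℂ] L2)

section

variable {q : R3 → ℂ} {hq : Measurable q} {C : ℝ} {hC : ∀ ξ, ‖q ξ‖ ≤ C}

theorem fourier_fourierMul (f : L2) : 𝓕 (fourierMul q hq C hC f) = bddMul q hq C hC (𝓕 f : L2) :=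
  (Lp.fourierTransformₗᵢ R3 ℂ).apply_symm_apply _

theorem inner_fourierMul (f g : L2) : inner ℂ g (fourierMul q hq C hC f) =
    ∫ ξ, q ξ * inner ℂ ((𝓕 g : L2) ξ) ((𝓕 f : L2) ξ) := by
  rw [← Lp.inner_fourier_eq, fourier_fourierMul, inner_bddMul]

theorem norm_inner_fourierMul_le (f g : L2) :
    ‖inner ℂ g (fourierMul q hq C hC f)‖ ≤ C * ‖f‖ * ‖g‖ := by
  rw [← Lp.inner_fourier_eq, fourier_fourierMul, ← Lp.norm_fourier_eq f, ← Lp.norm_fourier_eq g,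
    mul_comm]
  exact (norm_inner_le_norm _ _).trans
    (mul_le_mul_of_nonneg_left (norm_bddMul_le _) (norm_nonneg _))

end

/-! ### The one-dimensional Helmholtz kernel -/

theorem integrable_exp_neg_mul_abs {c : ℝ} (hc : 0 < c) :
    Integrable fun t : ℝ => Real.exp (-c * |t|) := by
  rw [← integrableOn_univ, ← Set.Iic_union_Ioi (a := (0 : ℝ)), integrableOn_union]
  constructor
  · refine (integrableOn_exp_mul_Iic hc 0).congr_fun (fun t ht => ?_) measurableSet_Iic
    simp only [abs_of_nonpos (Set.mem_Iic.1 ht), neg_mul_neg]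
  · refine (integrableOn_exp_mul_Ioi (neg_neg_of_pos hc) 0).congr_fun (fun t ht => ?_)
      measurableSet_Ioi
    simp only [abs_of_pos (Set.mem_Ioi.1 ht)]

/-- The two half-lines contribute `1/(σ - η)` and `1/(σ + η)` with `η = 2πiτ`. -/
theorem integral_exp_neg_mul_abs_mul_fourierChar {σ : ℂ} (hσ : 0 < σ.re) (τ : ℝ) :
    ∫ t : ℝ, Complex.exp (-σ * |t|) * (Real.fourierChar (-(t * τ)) : ℂ) =
      2 * σ / (σ ^ 2 + ((2 * Real.pi * τ : ℝ) : ℂ) ^ 2) := by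
  set η : ℂ := ((2 * Real.pi * τ : ℝ) : ℂ) * Complex.I with hη
  have hre : η.re = 0 := by simp [hη]
  have hchar : ∀ t : ℝ, (Real.fourierChar (-(t * τ)) : ℂ) = Complex.exp (-η * t) := fun t => by
    rw [Real.fourierChar_apply, hη]
    congr 1
    push_cast
    ring
  have h1 : (-σ - η).re < 0 := by simp [hre, hσ]
  have h2 : 0 < (σ - η).re := by simp [hre, hσ]
  have hpos : ∀ t ∈ Set.Ioi (0 : ℝ), Complex.exp ((-σ - η) * t) =
      Complex.exp (-σ * |t|) * (Real.fourierChar (-(t * τ)) : ℂ) := fun t ht => by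
    rw [hchar, abs_of_pos ht, ← Complex.exp_add]
    ring_nf
  have hneg : ∀ t ∈ Set.Iic (0 : ℝ), Complex.exp ((σ - η) * t) =
      Complex.exp (-σ * |t|) * (Real.fourierChar (-(t * τ)) : ℂ) := fun t ht => by
    rw [hchar, abs_of_nonpos ht, ← Complex.exp_add]
    push_cast
    ring_nf
  rw [← intervalIntegral.integral_Iic_add_Ioi (b := 0)
    ((integrableOn_exp_mul_complex_Iic h2 0).congr_fun hneg measurableSet_Iic)
    ((integrableOn_exp_mul_complex_Ioi h1 0).congr_fun hpos measurableSet_Ioi),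
    ← setIntegral_congr_fun measurableSet_Iic hneg, ← setIntegral_congr_fun measurableSet_Ioi hpos,
    integral_exp_mul_complex_Iic h2, integral_exp_mul_complex_Ioi h1]
  have e1 : σ - η ≠ 0 := fun h => by rw [h] at h2; simp at h2
  have e2 : -σ - η ≠ 0 := fun h => by rw [h] at h1; simp at h1
  have e3 : σ ^ 2 + ((2 * Real.pi * τ : ℝ) : ℂ) ^ 2 = -((σ - η) * (-σ - η)) := by
    have : η ^ 2 = -((2 * Real.pi * τ : ℝ) : ℂ) ^ 2 := by rw [hη, mul_pow, Complex.I_sq]; ring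
    linear_combination this
  rw [e3]
  simp only [Complex.ofReal_zero, mul_zero, Complex.exp_zero]
  field_simp
  ring

/-- The square root of `(2π|y|)² - z²` with positive real part. -/
def transverseRoot (z : ℂ) (y : R2) : ℂ :=
  ((((2 * Real.pi * ‖y‖) ^ 2 : ℝ) : ℂ) - z ^ 2) ^ (2⁻¹ : ℂ)

theorem transverseRoot_sq (z : ℂ) (y : R2) :
    transverseRoot z y ^ 2 = (((2 * Real.pi * ‖y‖) ^ 2 : ℝ) : ℂ) - z ^ 2 := by
  have := Complex.cpow_nat_inv_pow ((((2 * Real.pi * ‖y‖) ^ 2 : ℝ) : ℂ) - z ^ 2) two_ne_zero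
  exact_mod_cast this

theorem measurable_transverseRoot (z : ℂ) : Measurable (transverseRoot z) := by
  unfold transverseRoot
  exact Measurable.pow_const (by fun_prop) _

theorem im_sq (z : ℂ) : (z ^ 2).im = 2 * (z.re * z.im) := by
  rw [sq, Complex.mul_im]; ring

/-- The principal root has nonnegative real part; a purely imaginary root would have a real square,
but `Im σ² = -2 Re z Im z ≠ 0`. -/
theorem transverseRoot_re_pos {z : ℂ} (hz : z.re * z.im ≠ 0) (y : R2) :
    0 < (transverseRoot z y).re := by
  have h0 : 0 ≤ (transverseRoot z y).re := by
    rw [transverseRoot, Complex.cpow_inv_two_re]; exact Real.sqrt_nonneg _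
  refine h0.lt_of_ne fun h => hz ?_
  have h1 := congrArg Complex.im (transverseRoot_sq z y)
  rw [im_sq, Complex.sub_im, Complex.ofReal_im, im_sq, ← h] at h1
  linarith

theorem norm_transverseRoot_le {z : ℂ} {y : R2} (hy : 2 * Real.pi * ‖y‖ ≤ 2 * ‖z‖) :
    ‖transverseRoot z y‖ ≤ 3 * ‖z‖ := by
  have h1 : ‖transverseRoot z y‖ ^ 2 ≤ (2 * ‖z‖) ^ 2 + ‖z‖ ^ 2 := by
    rw [← norm_pow, transverseRoot_sq, ← norm_pow z]
    refine (norm_sub_le _ _).trans (add_le_add_left ?_ _)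
    rw [Complex.norm_real, Real.norm_of_nonneg (by positivity)]
    exact pow_le_pow_left₀ (by positivity) hy 2
  exact le_of_sq_le_sq (by nlinarith [sq_nonneg ‖z‖]) (by positivity)

/-- Comparing imaginary parts of `σ²` gives `Re σ |Im σ| = |Re z Im z|`, and `|Im σ| ≤ 3|z|` below
the cut-off. -/
theorem le_transverseRoot_re {z : ℂ} (hz : z.re * z.im ≠ 0) {y : R2}
    (hy : 2 * Real.pi * ‖y‖ ≤ 2 * ‖z‖) :
    |z.re * z.im| / (3 * ‖z‖) ≤ (transverseRoot z y).re := by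
  have hz0 : z ≠ 0 := fun h => hz (by simp [h])
  have hpos := transverseRoot_re_pos hz y
  have h1 := congrArg Complex.im (transverseRoot_sq z y)
  rw [im_sq, Complex.sub_im, Complex.ofReal_im, im_sq] at h1
  have h2 : |z.re * z.im| = (transverseRoot z y).re * |(transverseRoot z y).im| := by
    have h3 : z.re * z.im = -((transverseRoot z y).re * (transverseRoot z y).im) := by linarith
    rw [h3, abs_neg, abs_mul, abs_of_pos hpos]
  rw [div_le_iff₀ (by positivity), h2]
  exact mul_le_mul_of_nonneg_left
    ((Complex.abs_im_le_norm _).trans (norm_transverseRoot_le hy)) hpos.le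

/-- The kernel in the variable dual to `ξ_j` of the singular part of the resolvent. -/
def helmholtzKernel (z : ℂ) (t : ℝ) (y : R2) : ℂ :=
  if 2 * Real.pi * ‖y‖ ≤ 2 * ‖z‖ then
    -(transverseRoot z y / z) * Complex.exp (-transverseRoot z y * |t|) else 0

theorem measurable_helmholtzKernel (z : ℂ) :
    Measurable (Function.uncurry (helmholtzKernel z)) := by
  have h : Measurable fun p : ℝ × R2 => transverseRoot z p.2 :=
    (measurable_transverseRoot z).comp measurable_snd
  refine Measurable.ite (measurableSet_le (by fun_prop) measurable_const) ?_ measurable_const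
  have h1 : Measurable fun p : ℝ × R2 => ((|p.1| : ℝ) : ℂ) := by fun_prop
  exact (h.div_const z).neg.mul (Complex.measurable_exp.comp (h.neg.mul h1))

/-- The decay rate degenerates as `Im z → 0`; it provides integrability in `t`, while the prefactor
3 is the uniform bound. -/
theorem norm_helmholtzKernel_le_exp {z : ℂ} (hz : z.re * z.im ≠ 0) (t : ℝ) (y : R2) :
    ‖helmholtzKernel z t y‖ ≤ 3 * Real.exp (-(|z.re * z.im| / (3 * ‖z‖)) * |t|) := by
  have hz0 : 0 < ‖z‖ := norm_pos_iff.2 fun h => hz (by simp [h])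
  unfold helmholtzKernel
  split_ifs with hy
  · rw [norm_mul, norm_neg, norm_div, Complex.norm_exp]
    refine mul_le_mul ?_ (Real.exp_le_exp.2 ?_) (by positivity) (by norm_num)
    · rw [div_le_iff₀ hz0]
      exact norm_transverseRoot_le hy
    · rw [Complex.re_mul_ofReal, Complex.neg_re]
      have := mul_le_mul_of_nonneg_right (le_transverseRoot_re hz hy) (abs_nonneg t)
      linarith
  · rw [norm_zero]; positivity

theorem norm_helmholtzKernel_le {z : ℂ} (hz : z.re * z.im ≠ 0) (t : ℝ) (y : R2) :
    ‖helmholtzKernel z t y‖ ≤ 3 := by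
  refine (norm_helmholtzKernel_le_exp hz t y).trans ?_
  have : Real.exp (-(|z.re * z.im| / (3 * ‖z‖)) * |t|) ≤ 1 := by
    rw [Real.exp_le_one_iff, neg_mul, neg_nonpos]; positivity
  linarith

/-! ### Decomposition of the symbol of the resolvent -/

/-- The part of the symbol of the resolvent that is singular where `ξ_j` is away from `0`. -/
def singularSymbol (z : ℂ) (j : Fin 3) (ξ : R3) : ℂ :=
  if 2 * Real.pi * ‖dropCoord j ξ‖ ≤ 2 * ‖z‖ then
    -(2 / z) * (((((2 * Real.pi * ‖dropCoord j ξ‖) ^ 2 : ℝ) : ℂ) - z ^ 2) /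
      ((((2 * Real.pi * ‖ξ‖) ^ 2 : ℝ) : ℂ) - z ^ 2)) else 0

theorem measurable_singularSymbol (z : ℂ) (j : Fin 3) : Measurable (singularSymbol z j) := by
  have h := measurable_dropCoord j
  refine Measurable.ite (measurableSet_le (by fun_prop) measurable_const) ?_ measurable_const
  fun_prop

/-- The prefactor `-σ/z` turns `2σ/(σ² + (2πξⱼ)²)` into `-(2/z) σ²/(σ² + (2πξⱼ)²)`, whose
denominator is `(2π|ξ|)² - z²`. -/
theorem integral_helmholtzKernel {z : ℂ} (hz : z.re * z.im ≠ 0) (j : Fin 3) (ξ : R3) :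
    ∫ t : ℝ, helmholtzKernel z t (dropCoord j ξ) * (Real.fourierChar (-(t * ξ j)) : ℂ) =
      singularSymbol z j ξ := by
  unfold helmholtzKernel singularSymbol
  split_ifs with hy
  · simp only [mul_assoc (-(transverseRoot z _ / z))]
    rw [integral_const_mul, integral_exp_neg_mul_abs_mul_fourierChar (transverseRoot_re_pos hz _)]
    have e : transverseRoot z (dropCoord j ξ) ^ 2 + ((2 * Real.pi * ξ j : ℝ) : ℂ) ^ 2 =
        (((2 * Real.pi * ‖ξ‖) ^ 2 : ℝ) : ℂ) - z ^ 2 := by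
      rw [transverseRoot_sq, mul_pow _ ‖ξ‖, norm_sq_eq_split j ξ]
      push_cast
      ring
    rw [e, ← transverseRoot_sq]
    ring
  · simp

theorem abs_im_sq_le (z : ℂ) (r : ℝ) : 2 * |z.re * z.im| ≤ ‖(r : ℂ) - z ^ 2‖ := by
  refine le_trans (le_of_eq ?_) (Complex.abs_im_le_norm _)
  rw [Complex.sub_im, Complex.ofReal_im, im_sq, zero_sub, abs_neg, abs_mul 2, abs_two]

/-- This bound blows up as `Im z → 0`. It only makes the multiplier a bounded operator on `L²` and
leaves no trace in the final constant. -/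
theorem norm_singularSymbol_le {z : ℂ} (hz : z.re * z.im ≠ 0) (j : Fin 3) (ξ : R3) :
    ‖singularSymbol z j ξ‖ ≤ 2 / ‖z‖ * ((3 * ‖z‖) ^ 2 / (2 * |z.re * z.im|)) := by
  have hz' : 0 < |z.re * z.im| := abs_pos.2 hz
  unfold singularSymbol
  split_ifs with hy
  · rw [norm_mul, norm_neg, norm_div, norm_div, ← transverseRoot_sq, norm_pow, Complex.norm_two]
    have h1 := norm_transverseRoot_le hy
    have h2 := abs_im_sq_le z ((2 * Real.pi * ‖ξ‖) ^ 2)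
    gcongr
  · rw [norm_zero]; positivity

/-- The symbol of the resolvent of `|∇|`. -/
def resolventSymbol (z : ℂ) (ξ : R3) : ℂ := (absGradSymbol ξ - z)⁻¹

theorem measurable_absGradSymbol : Measurable absGradSymbol := by
  unfold absGradSymbol; fun_prop

theorem measurable_resolventSymbol (z : ℂ) : Measurable (resolventSymbol z) :=
  (measurable_absGradSymbol.sub_const z).inv

theorem abs_im_le_norm_absGradSymbol_sub (z : ℂ) (ξ : R3) : |z.im| ≤ ‖absGradSymbol ξ - z‖ := by
  refine le_trans (le_of_eq ?_) (Complex.abs_im_le_norm _)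
  rw [Complex.sub_im, absGradSymbol, Complex.ofReal_im, zero_sub, abs_neg]

theorem absGradSymbol_sub_ne_zero {z : ℂ} (hz : z.im ≠ 0) (ξ : R3) : absGradSymbol ξ - z ≠ 0 :=
  norm_pos_iff.1 ((abs_pos.2 hz).trans_le (abs_im_le_norm_absGradSymbol_sub z ξ))

theorem norm_resolventSymbol_le {z : ℂ} (hz : z.im ≠ 0) (ξ : R3) :
    ‖resolventSymbol z ξ‖ ≤ |z.im|⁻¹ := by
  rw [resolventSymbol, norm_inv]
  exact inv_anti₀ (abs_pos.2 hz) (abs_im_le_norm_absGradSymbol_sub z ξ)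

/-- What remains of the symbol of the resolvent after subtraction of its singular parts. -/
def regularSymbol (z : ℂ) (ξ : R3) : ℂ := resolventSymbol z ξ - ∑ j, singularSymbol z j ξ

theorem measurable_regularSymbol (z : ℂ) : Measurable (regularSymbol z) :=
  (measurable_resolventSymbol z).sub
    (Finset.measurable_fun_sum _ fun j _ => measurable_singularSymbol z j)

/-- Below the cut-off the difference is exactly `2/z`. Above it `r > 2|z|`, so `|r² - z²| ≥ (3/4)
r²` and the quotient is nonsingular. -/
theorem norm_sub_singularSymbol_le {z : ℂ} (hz : z.re * z.im ≠ 0) (j : Fin 3) (ξ : R3) :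
    ‖2 / z * ((((2 * Real.pi * ξ j) ^ 2 : ℝ) : ℂ) / ((((2 * Real.pi * ‖ξ‖) ^ 2 : ℝ) : ℂ) - z ^ 2)) -
      singularSymbol z j ξ‖ ≤ 3 / ‖z‖ := by
  have hz0 : z ≠ 0 := fun h => hz (by simp [h])
  have hzn : 0 < ‖z‖ := norm_pos_iff.2 hz0
  have hden : (((2 * Real.pi * ‖ξ‖) ^ 2 : ℝ) : ℂ) - z ^ 2 ≠ 0 := by
    have := abs_im_sq_le z ((2 * Real.pi * ‖ξ‖) ^ 2)
    exact norm_pos_iff.1 (lt_of_lt_of_le (by have := abs_pos.2 hz; positivity) this)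
  have hsplit : (2 * Real.pi * ‖ξ‖) ^ 2 =
      (2 * Real.pi * ξ j) ^ 2 + (2 * Real.pi * ‖dropCoord j ξ‖) ^ 2 := by
    rw [mul_pow _ ‖ξ‖, norm_sq_eq_split j ξ]; ring
  unfold singularSymbol
  split_ifs with hy
  · have e : 2 / z * ((((2 * Real.pi * ξ j) ^ 2 : ℝ) : ℂ) /
        ((((2 * Real.pi * ‖ξ‖) ^ 2 : ℝ) : ℂ) - z ^ 2)) -
        -(2 / z) * (((((2 * Real.pi * ‖dropCoord j ξ‖) ^ 2 : ℝ) : ℂ) - z ^ 2) /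
        ((((2 * Real.pi * ‖ξ‖) ^ 2 : ℝ) : ℂ) - z ^ 2)) = 2 / z := by
      rw [neg_mul, sub_neg_eq_add, ← mul_add, ← add_div]
      have : (((2 * Real.pi * ξ j) ^ 2 : ℝ) : ℂ) +
          ((((2 * Real.pi * ‖dropCoord j ξ‖) ^ 2 : ℝ) : ℂ) - z ^ 2) =
          (((2 * Real.pi * ‖ξ‖) ^ 2 : ℝ) : ℂ) - z ^ 2 := by
        rw [hsplit]; push_cast; ring
      rw [this, div_self hden, mul_one]
    rw [e, norm_div, Complex.norm_two]
    gcongr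
    norm_num
  · rw [sub_zero, norm_mul, norm_div, norm_div, Complex.norm_two, Complex.norm_real,
      Real.norm_of_nonneg (by positivity)]
    rw [not_le] at hy
    have h1 : (2 * ‖z‖) ^ 2 ≤ (2 * Real.pi * ‖ξ‖) ^ 2 := by
      rw [hsplit]
      nlinarith [sq_nonneg (2 * Real.pi * ξ j), pow_le_pow_left₀ (by positivity) hy.le 2]
    have h2 : (2 * Real.pi * ‖ξ‖) ^ 2 - ‖z‖ ^ 2 ≤
        ‖(((2 * Real.pi * ‖ξ‖) ^ 2 : ℝ) : ℂ) - z ^ 2‖ := by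
      refine le_trans (le_of_eq ?_) (norm_sub_norm_le _ _)
      rw [norm_pow, Complex.norm_real, Real.norm_of_nonneg (by positivity)]
    have h3 : (2 * Real.pi * ξ j) ^ 2 ≤ (2 * Real.pi * ‖ξ‖) ^ 2 := by
      rw [hsplit]; exact le_add_of_nonneg_right (by positivity)
    have h4 : (2 * Real.pi * ξ j) ^ 2 / ‖(((2 * Real.pi * ‖ξ‖) ^ 2 : ℝ) : ℂ) - z ^ 2‖ ≤ 3 / 2 := by
      rw [div_le_iff₀ (norm_pos_iff.2 hden)]
      nlinarith
    calc 2 / ‖z‖ * ((2 * Real.pi * ξ j) ^ 2 / ‖(((2 * Real.pi * ‖ξ‖) ^ 2 : ℝ) : ℂ) - z ^ 2‖)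
        ≤ 2 / ‖z‖ * (3 / 2) := by gcongr
      _ = 3 / ‖z‖ := by ring

theorem norm_regularSymbol_le {z : ℂ} (hre : 0 < z.re) (him : z.im ≠ 0) (ξ : R3) :
    ‖regularSymbol z ξ‖ ≤ 12 / ‖z‖ := by
  have hz : z.re * z.im ≠ 0 := mul_ne_zero hre.ne' him
  have hz0 : z ≠ 0 := fun h => hz (by simp [h])
  have hzn : 0 < ‖z‖ := norm_pos_iff.2 hz0
  set r : ℝ := 2 * Real.pi * ‖ξ‖ with hr
  have hr0 : 0 ≤ r := by positivity
  have hadd : ‖z‖ ≤ ‖(r : ℂ) + z‖ := by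
    refine le_of_sq_le_sq ?_ (norm_nonneg _)
    rw [Complex.sq_norm, Complex.sq_norm, Complex.normSq_apply, Complex.normSq_apply]
    simp only [Complex.add_re, Complex.add_im, Complex.ofReal_re, Complex.ofReal_im]
    nlinarith [mul_nonneg hr0 hre.le]
  have hadd0 : (r : ℂ) + z ≠ 0 := norm_pos_iff.1 (hzn.trans_le hadd)
  have hsub0 : (r : ℂ) - z ≠ 0 := absGradSymbol_sub_ne_zero him ξ
  have hden : ((r ^ 2 : ℝ) : ℂ) - z ^ 2 = ((r : ℂ) + z) * ((r : ℂ) - z) := by push_cast; ring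
  have hsum : ∑ j, (2 * Real.pi * ξ j) ^ 2 = r ^ 2 := by
    rw [hr, mul_pow _ ‖ξ‖, EuclideanSpace.real_norm_sq_eq, Finset.mul_sum]
    exact Finset.sum_congr rfl fun j _ => by ring
  -- Partial fractions in `r`, followed by `r² = ∑ⱼ (2πξⱼ)²` to distribute the singular term over
  -- the three directions.
  have hid : regularSymbol z ξ = ((r : ℂ) + z)⁻¹ - 2 / z +
      ∑ j, (2 / z * ((((2 * Real.pi * ξ j) ^ 2 : ℝ) : ℂ) / (((r ^ 2 : ℝ) : ℂ) - z ^ 2)) -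
        singularSymbol z j ξ) := by
    rw [Finset.sum_sub_distrib, ← Finset.mul_sum, ← Finset.sum_div, ← Complex.ofReal_sum, hsum,
      hden, regularSymbol, resolventSymbol]
    change ((r : ℂ) - z)⁻¹ - _ = _
    rw [← add_sub_assoc]
    congr 1
    push_cast
    field_simp
    ring
  rw [hid]
  have h1 : ‖((r : ℂ) + z)⁻¹‖ ≤ 1 / ‖z‖ := by
    rw [norm_inv, one_div]; exact inv_anti₀ hzn hadd
  have h2 : ‖2 / z‖ = 2 / ‖z‖ := by rw [norm_div, Complex.norm_two]
  have h3 := norm_sum_le_of_le Finset.univ fun j _ => norm_sub_singularSymbol_le hz j ξ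
  rw [Finset.sum_const, Finset.card_univ, Fintype.card_fin, nsmul_eq_mul] at h3
  calc _ ≤ ‖((r : ℂ) + z)⁻¹ - 2 / z‖ + _ := norm_add_le _ _
    _ ≤ (1 / ‖z‖ + 2 / ‖z‖) + ((3 : ℕ) : ℝ) * (3 / ‖z‖) :=
        add_le_add ((norm_sub_le _ _).trans (add_le_add h1 h2.le)) h3
    -- Here `12 = 1 + 2 + 3 · 3`.
    _ = 12 / ‖z‖ := by push_cast; ring

/-! ### The resolvent of `|∇|` -/

/-- The operator with symbol `(2π|ξ| - z)⁻¹`. -/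
def absGradResolvent (z : ℂ) (hz : z.im ≠ 0) : L2 →L[ℂ] L2 :=
  fourierMul (resolventSymbol z) (measurable_resolventSymbol z) _ (norm_resolventSymbol_le hz)

theorem fourier_absGradResolvent {z : ℂ} (hz : z.im ≠ 0) (f : L2) :
    (𝓕 (absGradResolvent z hz f) : L2) =ᵐ[volume]
      fun ξ => resolventSymbol z ξ * (𝓕 f : L2) ξ := by
  rw [absGradResolvent, fourier_fourierMul]
  exact coeFn_bddMul _

theorem fourier_absGrad (u : absGrad.domain) :
    (𝓕 (absGrad u) : L2) =ᵐ[volume] absGradHat u := by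
  have h : (𝓕 (absGrad u) : L2) = MemLp.toLp (absGradHat u) u.2 :=
    FourierTransform.fourier_fourierInv_eq _
  rw [h]
  exact MemLp.coeFn_toLp _

theorem fourier_absGrad_sub_smul (z : ℂ) (u : absGrad.domain) :
    (𝓕 (absGrad u - z • (u : L2)) : L2) =ᵐ[volume]
      fun ξ => (absGradSymbol ξ - z) * (𝓕 (u : L2) : L2) ξ := by
  have h : (𝓕 (absGrad u - z • (u : L2)) : L2) = 𝓕 (absGrad u) - z • (𝓕 (u : L2) : L2) := by
    have := map_sub (Lp.fourierTransformₗᵢ R3 ℂ) (absGrad u) (z • (u : L2))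
    rw [map_smul] at this
    exact this
  rw [h]
  filter_upwards [Lp.coeFn_sub (𝓕 (absGrad u) : L2) (z • (𝓕 (u : L2) : L2)),
    Lp.coeFn_smul z (𝓕 (u : L2) : L2), fourier_absGrad u] with ξ h1 h2 h3
  rw [h1, Pi.sub_apply, h2, h3, Pi.smul_apply, smul_eq_mul, absGradHat, sub_mul]

theorem fourier_injective_L2 {u v : L2} (h : (𝓕 u : L2) =ᵐ[volume] (𝓕 v : L2)) : u = v :=
  (Lp.fourierTransformₗᵢ R3 ℂ).injective (Lp.ext h)

theorem isResolvent_absGradResolvent {z : ℂ} (hz : z.im ≠ 0) :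
    IsResolvent absGrad z (absGradResolvent z hz) := by
  have hinv : ∀ ξ, (absGradSymbol ξ - z) * resolventSymbol z ξ = 1 := fun ξ =>
    mul_inv_cancel₀ (absGradSymbol_sub_ne_zero hz ξ)
  refine ⟨fun f => ?_, fun u => ?_⟩
  · have hmem : absGradResolvent z hz f ∈ absGrad.domain := by
      change MemLp (absGradHat _) 2 volume
      have h1 : absGradHat (absGradResolvent z hz f) =ᵐ[volume]
          fun ξ => (𝓕 f : L2) ξ + z * (𝓕 (absGradResolvent z hz f) : L2) ξ := by
        filter_upwards [fourier_absGradResolvent hz f] with ξ h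
        simp only [absGradHat, h]
        linear_combination (𝓕 f : L2) ξ * hinv ξ
      have h2 : MemLp (fun ξ => (𝓕 f : L2) ξ) 2 volume := Lp.memLp (𝓕 f : L2)
      have h3 : MemLp (fun ξ => z * (𝓕 (absGradResolvent z hz f) : L2) ξ) 2 volume :=
        (Lp.memLp (𝓕 (absGradResolvent z hz f) : L2)).const_mul z
      exact (memLp_congr_ae h1).2 (h2.add h3)
    refine ⟨hmem, fourier_injective_L2 ?_⟩
    filter_upwards [fourier_absGrad_sub_smul z ⟨_, hmem⟩, fourier_absGradResolvent hz f]
      with ξ h1 h2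
    rw [h1, h2, ← mul_assoc, hinv, one_mul]
  · refine fourier_injective_L2 ?_
    filter_upwards [fourier_absGrad_sub_smul z u, fourier_absGradResolvent hz _] with ξ h1 h2
    rw [h2, h1, ← mul_assoc, mul_comm (resolventSymbol z ξ), hinv, one_mul]

/-! ### Weighted estimates -/

/-- The Fourier multiplier with symbol `singularSymbol z j`. -/
def singularPart {z : ℂ} (hz : z.re * z.im ≠ 0) (j : Fin 3) : L2 →L[ℂ] L2 :=
  fourierMul (singularSymbol z j) (measurable_singularSymbol z j) _ (norm_singularSymbol_le hz j)

theorem norm_inner_singularPart_le {z : ℂ} (hz : z.re * z.im ≠ 0) {s : ℝ} (hs : 1 / 2 < s)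
    (j : Fin 3) {f g u v : L2} (hu : u =ᵐ[volume] weighted s f) (hv : v =ᵐ[volume] weighted s g) :
    ‖inner ℂ g (singularPart hz j f)‖ ≤ 6 * slabConst s ^ 2 * ‖u‖ * ‖v‖ := by
  refine norm_inner_le_of_slab_bound hs j _ (by norm_num) (fun n m f g hf hg => ?_) hu hv
  have hz0 : z ≠ 0 := fun h => hz (by simp [h])
  have hc : 0 < |z.re * z.im| / (3 * ‖z‖) := by
    have := abs_pos.2 hz
    positivity
  have h := norm_inner_multiplier_le_of_slab hf hg (measurable_helmholtzKernel z)
    (norm_helmholtzKernel_le hz) ((integrable_exp_neg_mul_abs hc).const_mul 3)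
    (norm_helmholtzKernel_le_exp hz)
  simp only [integral_helmholtzKernel hz] at h
  rw [singularPart, inner_fourierMul]
  -- The 6 is the interval length 2 times the kernel bound 3.
  refine h.trans (le_of_eq (by ring))

theorem absGradResolvent_eq {z : ℂ} (hre : 0 < z.re) (him : z.im ≠ 0) (f g : L2) :
    inner ℂ g (absGradResolvent z him f) =
      inner ℂ g (fourierMul (regularSymbol z) (measurable_regularSymbol z) _
        (norm_regularSymbol_le hre him) f) +
      ∑ j, inner ℂ g (singularPart (mul_ne_zero hre.ne' him) j f) := by
  have hz := mul_ne_zero hre.ne' him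
  have hP : Integrable fun ξ : R3 => inner ℂ ((𝓕 g : L2) ξ) ((𝓕 f : L2) ξ) :=
    L2.integrable_inner _ _
  have hsing : ∀ j, Integrable fun ξ : R3 =>
      singularSymbol z j ξ * inner ℂ ((𝓕 g : L2) ξ) ((𝓕 f : L2) ξ) := fun j =>
    hP.bdd_mul (measurable_singularSymbol z j).aestronglyMeasurable
      (.of_forall (norm_singularSymbol_le hz j))
  have hreg : Integrable fun ξ : R3 =>
      regularSymbol z ξ * inner ℂ ((𝓕 g : L2) ξ) ((𝓕 f : L2) ξ) :=
    hP.bdd_mul (measurable_regularSymbol z).aestronglyMeasurable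
      (.of_forall (norm_regularSymbol_le hre him))
  simp only [absGradResolvent, singularPart, inner_fourierMul]
  rw [← integral_finsetSum _ fun j _ => hsing j,
    ← integral_add hreg (integrable_finsetSum _ fun j _ => hsing j)]
  refine integral_congr_ae (.of_forall fun ξ => ?_)
  simp only [regularSymbol, ← Finset.sum_mul]
  ring

theorem one_le_weight {s : ℝ} (hs : 0 ≤ s) (x : R3) : 1 ≤ Real.sqrt (1 + ‖x‖ ^ 2) ^ s :=
  Real.one_le_rpow (Real.one_le_sqrt.2 (le_add_of_nonneg_right (sq_nonneg _))) hs

theorem norm_le_norm_weighted {s : ℝ} (hs : 0 ≤ s) {f u : L2} (hu : u =ᵐ[volume] weighted s f) :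
    ‖f‖ ≤ ‖u‖ := by
  refine Lp.norm_le_norm_of_ae_le ?_
  filter_upwards [hu] with x hx
  rw [hx, weighted, norm_mul, Complex.norm_real, Real.norm_of_nonneg (by positivity)]
  exact le_mul_of_one_le_left (norm_nonneg _) (one_le_weight hs x)

theorem norm_inner_absGradResolvent_le {z : ℂ} (hre : 0 < z.re) (him : z.im ≠ 0) {s : ℝ}
    (hs : 1 / 2 < s) {f g u v : L2} (hu : u =ᵐ[volume] weighted s f)
    (hv : v =ᵐ[volume] weighted s g) :
    ‖inner ℂ g (absGradResolvent z him f)‖ ≤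
      (12 / ‖z‖ + 18 * slabConst s ^ 2) * ‖u‖ * ‖v‖ := by
  have hs0 : 0 ≤ s := by linarith
  have h1 := norm_inner_fourierMul_le (hq := measurable_regularSymbol z)
    (hC := norm_regularSymbol_le hre him) f g
  have h2 := norm_sum_le_of_le Finset.univ fun j _ =>
    norm_inner_singularPart_le (mul_ne_zero hre.ne' him) hs j hu hv
  rw [Finset.sum_const, Finset.card_univ, Fintype.card_fin, nsmul_eq_mul] at h2
  have h3 : 12 / ‖z‖ * ‖f‖ * ‖g‖ ≤ 12 / ‖z‖ * ‖u‖ * ‖v‖ := by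
    have := norm_le_norm_weighted hs0 hu
    have := norm_le_norm_weighted hs0 hv
    gcongr
  rw [absGradResolvent_eq hre him]
  refine (norm_add_le _ _).trans ((add_le_add (h1.trans h3) h2).trans (le_of_eq ?_))
  push_cast
  ring

theorem measurable_weight (s : ℝ) :
    Measurable fun x : R3 => ((Real.sqrt (1 + ‖x‖ ^ 2) ^ s : ℝ) : ℂ) := by
  fun_prop

theorem norm_weight_neg_le {s : ℝ} (hs : 0 ≤ s) (x : R3) :
    ‖((Real.sqrt (1 + ‖x‖ ^ 2) ^ (-s) : ℝ) : ℂ)‖ ≤ 1 := by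
  rw [Complex.norm_real, Real.norm_of_nonneg (by positivity), Real.rpow_neg (by positivity)]
  exact inv_le_one_of_one_le₀ (one_le_weight hs x)

theorem weighted_weighted_neg (s : ℝ) (f : R3 → ℂ) : weighted s (weighted (-s) f) = f := by
  funext x
  rw [weighted, weighted, ← mul_assoc, ← Complex.ofReal_mul, ← Real.rpow_add (by positivity),
    add_neg_cancel, Real.rpow_zero, Complex.ofReal_one, one_mul]

/-- Multiplication by `⟨x⟩⁻ˢ` on `L²`. -/
def weightNegMul {s : ℝ} (hs : 0 ≤ s) : L2 →L[ℂ] L2 :=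
  bddMul _ (measurable_weight (-s)) 1 (norm_weight_neg_le hs)

theorem coeFn_weightNegMul {s : ℝ} (hs : 0 ≤ s) (u : L2) :
    weightNegMul hs u =ᵐ[volume] weighted (-s) u :=
  coeFn_bddMul u

theorem inner_weightNegMul {s : ℝ} (hs : 0 ≤ s) (u v : L2) :
    inner ℂ (weightNegMul hs v) u = inner ℂ v (weightNegMul hs u) := by
  rw [L2.inner_def, L2.inner_def]
  refine integral_congr_ae ?_
  filter_upwards [coeFn_weightNegMul hs u, coeFn_weightNegMul hs v] with x h1 h2
  rw [h1, h2, weighted, weighted]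
  simp only [RCLike.inner_apply, map_mul, Complex.conj_ofReal]
  ring

/-- Duality: with `v = ⟨x⟩⁻ˢ R f`, the test function `g = ⟨x⟩⁻ˢ v` gives `⟨g, R f⟩ = ‖v‖²` and has
weighted norm `‖v‖`, so one factor `‖v‖` cancels. -/
theorem norm_weightNegMul_absGradResolvent_le {z : ℂ} (hre : 0 < z.re) (him : z.im ≠ 0) {s : ℝ}
    (hs : 1 / 2 < s) (hs0 : 0 ≤ s) {f u : L2} (hu : u =ᵐ[volume] weighted s f) :
    ‖weightNegMul hs0 (absGradResolvent z him f)‖ ≤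
      (12 / ‖z‖ + 18 * slabConst s ^ 2) * ‖u‖ := by
  set v := weightNegMul hs0 (absGradResolvent z him f) with hv
  have hg : v =ᵐ[volume] weighted s (weightNegMul hs0 v) := by
    filter_upwards [coeFn_weightNegMul hs0 v] with x hx
    rw [weighted, hx]
    exact (congrFun (weighted_weighted_neg s v) x).symm
  have h := norm_inner_absGradResolvent_le hre him hs hu hg
  rw [inner_weightNegMul, ← hv, norm_inner_symm, inner_self_eq_norm_sq_to_K, norm_pow,
    RCLike.norm_ofReal, abs_norm, sq] at h
  rcases (norm_nonneg v).eq_or_lt with h0 | h0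
  · rw [← h0]; positivity
  · exact le_of_mul_le_mul_right h h0

end HalfWave

end

/-! ### The uniform limiting absorption principle -/

theorem mainTheorem6 (s a₀ : ℝ) (hs : 1 / 2 < s) (ha₀ : 0 < a₀) :
    ∃ C : ℝ, 0 < C ∧
      ∀ lam ε : ℝ, a₀ ≤ lam → 0 < ε →
        ∀ z : ℂ, (z = (lam : ℂ) + (ε : ℂ) * Complex.I ∨ z = (lam : ℂ) - (ε : ℂ) * Complex.I) →
          ∃ R : HalfWave.L2 →L[ℂ] HalfWave.L2,
            HalfWave.IsResolvent HalfWave.absGrad z R ∧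
              ∀ (f : HalfWave.R3 → ℂ) (hf : HalfWave.MemL2Weighted s f),
                HalfWave.MemL2Weighted (-s)
                    (R (MemLp.toLp f (hf.memLp (le_of_lt (lt_trans one_half_pos hs))))) ∧
                  HalfWave.l2WeightedNorm (-s)
                      (R (MemLp.toLp f (hf.memLp (le_of_lt (lt_trans one_half_pos hs))))) ≤
                    ENNReal.ofReal C * HalfWave.l2WeightedNorm s f := by
  have hs0 : 0 ≤ s := by linarith
  -- The first term bounds the regular part, using `|z| ≥ Re z = lam ≥ a₀`; the second is 6 for each
  -- of the three directions and does not depend on `a₀`.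
  refine ⟨12 / a₀ + 18 * HalfWave.slabConst s ^ 2, by positivity, fun lam ε hlam hε z hz => ?_⟩
  have hre : z.re = lam := by rcases hz with rfl | rfl <;> simp
  have him : z.im ≠ 0 := by rcases hz with rfl | rfl <;> simp [hε.ne']
  have hre0 : 0 < z.re := by linarith
  have hzn : a₀ ≤ ‖z‖ := by linarith [Complex.re_le_norm z]
  refine ⟨HalfWave.absGradResolvent z him, HalfWave.isResolvent_absGradResolvent him,
    fun f hf => ?_⟩
  set F : HalfWave.L2 := MemLp.toLp f (hf.memLp (le_of_lt (lt_trans one_half_pos hs))) with hF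
  have hu : hf.toLp _ =ᵐ[volume] HalfWave.weighted s F := by
    filter_upwards [MemLp.coeFn_toLp hf,
      MemLp.coeFn_toLp (hf.memLp (le_of_lt (lt_trans one_half_pos hs)))] with x h1 h2
    rw [h1, HalfWave.weighted, HalfWave.weighted, hF, h2]
  have hv := HalfWave.coeFn_weightNegMul hs0 (HalfWave.absGradResolvent z him F)
  refine ⟨(memLp_congr_ae hv).1 (Lp.memLp _), ?_⟩
  have hbound := HalfWave.norm_weightNegMul_absGradResolvent_le hre0 him hs hs0 hu
  have hC : (12 / ‖z‖ + 18 * HalfWave.slabConst s ^ 2) * ‖hf.toLp _‖ ≤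
      (12 / a₀ + 18 * HalfWave.slabConst s ^ 2) * ‖hf.toLp _‖ := by gcongr
  have h := ENNReal.ofReal_le_ofReal (hbound.trans hC)
  rw [ENNReal.ofReal_mul (by positivity), ofReal_norm, ofReal_norm,
    Lp.enorm_def, Lp.enorm_def, eLpNorm_congr_ae hv,
    eLpNorm_congr_ae (MemLp.coeFn_toLp hf)] at h
  exact h
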